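/- Fix a Gödel numbering of the first-order sentences over each finite relational vocabulary. Structures are nonempty; graphs are undirected and without loops. For a sentence $\varphi$ over the vocabulary $\{E\}$ of graphs ($E$ binary) let $\mathrm{Graph}_{\mathrm{fin}}(\varphi)$ be the class of finite graphs that are models of $\varphi$, and for a sentence $\varphi$ over a vocabulary $\tau$ let $\mathrm{Mod}_{\mathrm{fin}}(\varphi)$ be the class of finite $\tau$-structures that are models of $\varphi$. Then: (1) There is no algorithm that, applied to any first-order sentence $\varphi$ over $\{E\}$, decides whether the class $\mathrm{Graph}_{\mathrm{fin}}(\varphi)$ is closed under induced subgraphs. (2) Let $\tau$ be any finite relational vocabulary that contains a binary relation symbol. There is no algorithm that, applied to any first-order $\tau$-sentence $\varphi$, decides whether the class $\mathrm{Mod}_{\mathrm{fin}}(\varphi)$ is closed under induced substructures. More precisely, for every recursively enumerable set $W\subseteq\{0,1\}^*$ (for example, the set of inputs on which a given universal Turing machine halts) there is a computable map $w\mapsto\pi_w$ from words to $\tau$-sentences such that, for every $w\in\{0,1\}^*$, the class $\mathrm{Mod}_{\mathrm{fin}}(\pi_w)$ is closed under induced substructures if and only if $w\notin W$. -/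

import Mathlib

namespace FinClosure

open FirstOrder

/-- Number of a term over a relational vocabulary without free variables: such a term is one of the
variables `x_0, …, x_{n-1}`, and its number is the index of that variable. -/
def termCode {L : FirstOrder.Language.{0, 0}} [L.IsRelational] {n : ℕ} : L.Term (Empty ⊕ Fin n) → ℕ
  | .var (.inl e) => e.elim
  | .var (.inr i) => i
  | .func f _ => isEmptyElim f

/-- The Gödel number of a first-order formula, by recursion on its syntax tree. The relation symbols
are numbered by the given `Encodable` instance (for a finite vocabulary the choice is immaterial).
Sentences are the formulas with `n = 0`. -/
def code {L : FirstOrder.Language.{0, 0}} [L.IsRelational] [Encodable (Σ n, L.Relations n)] :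
    {n : ℕ} → L.BoundedFormula Empty n → ℕ
  | _, .falsum => Nat.pair 0 0
  | _, .equal t u => Nat.pair 1 (Nat.pair (termCode t) (termCode u))
  | _, .rel (l := l) R ts =>
      Nat.pair 2 (Nat.pair (Encodable.encode (⟨l, R⟩ : Σ n, L.Relations n))
        (Encodable.encode (List.ofFn fun i => termCode (ts i))))
  | _, .imp f g => Nat.pair 3 (Nat.pair (code f) (code g))
  | _, .all f => Nat.pair 4 (code f)

theorem termCode_injective {L : FirstOrder.Language.{0, 0}} [L.IsRelational] {n : ℕ} :
    Function.Injective (termCode : L.Term (Empty ⊕ Fin n) → ℕ) := by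
  intro t u h
  match t, u, h with
  | .var (.inr i), .var (.inr j), h =>
    have : i = j := Fin.ext h
    rw [this]
  | .var (.inl e), _, _ => exact e.elim
  | _, .var (.inl e), _ => exact e.elim
  | .func f _, _, _ => exact isEmptyElim f
  | _, .func f _, _ => exact isEmptyElim f

/-- Different formulas have different Gödel numbers. -/
theorem code_injective {L : FirstOrder.Language.{0, 0}} [L.IsRelational] [Encodable (Σ n, L.Relations n)] {n : ℕ} :
    Function.Injective (code : L.BoundedFormula Empty n → ℕ) := by
  intro f
  induction f with
  | falsum => intro g h; cases g <;> simp_all [code, Nat.pair_eq_pair]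
  | equal t u =>
    intro g h
    cases g <;> simp [code, Nat.pair_eq_pair] at h
    rw [termCode_injective h.1, termCode_injective h.2]
  | rel R ts =>
    intro g h
    cases g <;> simp [code, Nat.pair_eq_pair] at h
    obtain ⟨⟨rfl, h1⟩, h2⟩ := h
    obtain rfl := eq_of_heq h1
    congr
    funext i
    exact termCode_injective (congrFun (List.ofFn_injective h2) i)
  | imp f g ihf ihg =>
    intro k h
    cases k <;> simp [code, Nat.pair_eq_pair] at h
    rw [ihf h.1, ihg h.2]
  | all f ih =>
    intro k h
    cases k <;> simp [code, Nat.pair_eq_pair] at h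
    rw [ih h]

/-- There is an algorithm which, applied to (the Gödel number of) any sentence `φ`, halts and answers
correctly whether `φ` has the property `P`. Its behaviour on other numbers is irrelevant. -/
def DecidableOnSentences {L : FirstOrder.Language.{0, 0}} [L.IsRelational] [Encodable (Σ n, L.Relations n)]
    (P : L.Sentence → Prop) : Prop :=
  ∃ d : ℕ →. Bool, Partrec d ∧ ∀ φ : L.Sentence, ∃ b ∈ d (code φ), (b = true ↔ P φ)

/-- `Mod_fin(φ)` is closed under induced substructures: the (nonempty) induced substructures of each
finite model of `φ` are again models of `φ`. -/
def ModFinClosed {L : FirstOrder.Language.{0, 0}} (φ : L.Sentence) : Prop :=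
  ∀ (A : Type) [L.Structure A] [Finite A], A ⊨ φ →
    ∀ B : L.Substructure A, Nonempty B → B ⊨ φ

/-- The graph `G`, as a structure with the single binary relation of adjacency, is a model
of `φ`. -/
def GraphModels {V : Type} (G : SimpleGraph V) (φ : FirstOrder.Language.graph.Sentence) : Prop :=
  @Language.Sentence.Realize Language.graph V G.structure φ

/-- `Graph_fin(φ)` is closed under induced subgraphs: the (nonempty) induced subgraphs of each finite
graph that is a model of `φ` are again models of `φ`. -/
def GraphFinClosed (φ : FirstOrder.Language.graph.Sentence) : Prop :=
  ∀ (V : Type) [Finite V] (G : SimpleGraph V), GraphModels G φ →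
    ∀ S : Set V, S.Nonempty → GraphModels (G.induce S) φ

/-- The vocabulary of graphs has exactly one relation symbol, which receives the number `0`. -/
instance graphEncodable : Encodable (Σ n, Language.graph.Relations n) where
  encode _ := 0
  decode _ := some ⟨2, Language.adj⟩
  encodek := by rintro ⟨_, ⟨⟩⟩; rfl

end FinClosure

/-! Let `W` be a recursively enumerable set of words. Some code `c` halts on the number of a
word if and only if the word belongs to `W`. The proof constructs, computably in `n`, a sentence `haltingSentence r c n` with
no one-element models that has a finite model if and only if `c` halts on `n`. If such a sentence has
no finite model, the class of its finite models is closed under induced substructures for a trivial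
reason; if it has one, the class is not closed, as it contains none of the one-element substructures.
So closure for the sentence of `w` is equivalent to `w ∉ W`.

A finite model is a certificate of the computation (`IsCertificate`): a strict order whose elements
represent numbers by the size of their initial segments, and binary relations that claim facts
`a = (unpair x).1`, `b = (unpair x).2` and `y ∈ eval d x` for the finitely many codes `d` whose number
is at most that of `c`. First-order axioms require each claim to be justified by other claims, as in
the recursive definitions of pairing and evaluation. As the order is finite, all claims are then true
(`IsCertificate.unpair`, `IsCertificate.mem_eval`). Conversely, the facts about a computation with
bounded number of steps form a certificate (`FactOn.isCertificate`).

The relations of a certificate are coded in a single binary relation by paths of length three that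
are marked by edges to parameters (`Coded`). Existence of a coded certificate, with the parameters
quantified existentially, can be expressed over any vocabulary with a binary symbol, and a halting computation
is coded by a graph (`exists_graph_certifiesHalting`). The input enters the sentence only through a
chain of `n` existential quantifiers, which makes its Gödel number primitive recursive in `n`
(`primrec_code_haltsAfter`). -/

namespace FinClosure

open FirstOrder Nat.Partrec

/-! ### Certificates of computations -/

section Certificate

variable {M : Type} (R : ℕ → M → M → Prop)

/-- `x` has no predecessor in the order `R 0`. -/
def IsZero (x : M) : Prop := ∀ z, ¬ R 0 z x

/-- `y` is an immediate successor of `x` in the order `R 0`: everything below `y` is `x` or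
below `x`. -/
def IsSucc (x y : M) : Prop := R 0 x y ∧ ∀ z, R 0 z y → z = x ∨ R 0 z x

/-- The relations `R 1` and `R 2` claim that `x` is the number of the pair `(a, b)`. -/
def IsPair (x a b : M) : Prop := R 1 x a ∧ R 2 x b

/-- The relation `R (encode d + 3)` claims that the code `d` evaluates to `y` on the input `x`. -/
def Eval (d : Code) (x y : M) : Prop := R (Encodable.encode d + 3) x y

/-- `a'` is the first component of the pair that follows `(a, b)` in the order of `Nat.pair`. -/
def NextLeft (a b a' : M) : Prop :=
  (R 0 a b ∧ IsSucc R a a') ∨ (R 0 b a ∧ a' = a) ∨ (a = b ∧ IsZero R a')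

/-- `b'` is the second component of the pair that follows `(a, b)` in the order of `Nat.pair`. -/
def NextRight (a b b' : M) : Prop :=
  (R 0 b a ∧ IsSucc R b b') ∨ (a = b ∧ IsSucc R b b') ∨
    (∃ s, IsSucc R a s ∧ R 0 s b ∧ b' = b) ∨ (IsSucc R a b ∧ IsZero R b')

/-- Every claimed first component is justified: by the pair `(0, 0)` with number `0`, or by the pair
with the preceding number. -/
def LeftJustified : Prop := ∀ x a, R 1 x a → (IsZero R x ∧ IsZero R a) ∨
  ∃ x' b c, IsSucc R x' x ∧ IsPair R x' b c ∧ NextLeft R b c a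

/-- The analogue of `LeftJustified` for second components. -/
def RightJustified : Prop := ∀ x a, R 2 x a → (IsZero R x ∧ IsZero R a) ∨
  ∃ x' b c, IsSucc R x' x ∧ IsPair R x' b c ∧ NextRight R b c a

/-- The claim that the code evaluates to `y` on the input `x` is justified by claims about smaller
codes, or about the same code at an earlier stage of its recursion. -/
def EvalRule : Code → M → M → Prop
  | .zero, _, y => IsZero R y
  | .succ, x, y => IsSucc R x y
  | .left, x, y => R 1 x y
  | .right, x, y => R 2 x y
  | .pair f g, x, y => ∃ u v, Eval R f x u ∧ Eval R g x v ∧ IsPair R y u v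
  | .comp f g, x, y => ∃ u, Eval R g x u ∧ Eval R f u y
  | .prec f g, x, y => ∃ a n, IsPair R x a n ∧ ((IsZero R n ∧ Eval R f a y) ∨
      ∃ m z i q r, IsSucc R m n ∧ IsPair R z a m ∧ Eval R (.prec f g) z i ∧
        IsPair R q a r ∧ IsPair R r m i ∧ Eval R g q y)
  | .rfind' f, x, y => ∃ a m v, IsPair R x a m ∧ Eval R f x v ∧ ((IsZero R v ∧ y = m) ∨
      ((∃ z, R 0 z v) ∧ ∃ n z, IsSucc R m n ∧ IsPair R z a n ∧ Eval R (.rfind' f) z y))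

/-- The relations `R` form a certificate for evaluations of the codes with numbers at most `K`:
`R 0` is a strict order and all claims made by the other relations are justified. -/
structure IsCertificate (K : ℕ) : Prop where
  irrefl : ∀ x, ¬ R 0 x x
  trans : ∀ x y z, R 0 x y → R 0 y z → R 0 x z
  left : LeftJustified R
  right : RightJustified R
  eval : ∀ d : Code, Encodable.encode d ≤ K → ∀ x y, Eval R d x y → EvalRule R d x y

theorem isCertificate_iff {K : ℕ} : IsCertificate R K ↔ (∀ x, ¬ R 0 x x) ∧
    (∀ x y z, R 0 x y → R 0 y z → R 0 x z) ∧ LeftJustified R ∧ RightJustified R ∧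
    ∀ d : Code, Encodable.encode d ≤ K → ∀ x y, Eval R d x y → EvalRule R d x y :=
  ⟨fun ⟨h1, h2, h3, h4, h5⟩ => ⟨h1, h2, h3, h4, h5⟩,
    fun ⟨h1, h2, h3, h4, h5⟩ => ⟨h1, h2, h3, h4, h5⟩⟩

/-- The number represented by an element of a certificate: how many elements lie below it. -/
noncomputable def val (x : M) : ℕ := Set.ncard {z | R 0 z x}

variable {R} {K : ℕ}

/-- The rule for a code involves only the relations for that code, for its subcodes, and for
pairing. -/
theorem evalRule_congr {R' : ℕ → M → M → Prop} {d : Code}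
    (hR : ∀ t < Encodable.encode d + 4, R t = R' t) : EvalRule R d = EvalRule R' d := by
  have h0 := hR 0 (by omega)
  have h1 := hR 1 (by omega)
  have h2 := hR 2 (by omega)
  have hzero : IsZero R = IsZero R' := by unfold IsZero; rw [h0]
  have hsucc : IsSucc R = IsSucc R' := by unfold IsSucc; rw [h0]
  have hpair : IsPair R = IsPair R' := by unfold IsPair; rw [h1, h2]
  have heval : ∀ c : Code, Encodable.encode c ≤ Encodable.encode d → Eval R c = Eval R' c :=
    fun c hc => hR _ (by omega)
  have hd := heval d le_rfl
  ext x y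
  cases d with
  | zero => simp only [EvalRule, hzero]
  | succ => simp only [EvalRule, hsucc]
  | left => simp only [EvalRule, h1]
  | right => simp only [EvalRule, h2]
  | pair f g =>
    have hlt := Code.encode_lt_pair f g
    simp only [EvalRule, hpair, heval f (by omega), heval g (by omega)]
  | comp f g =>
    have hlt := Code.encode_lt_comp f g
    simp only [EvalRule, heval f (by omega), heval g (by omega)]
  | prec f g =>
    have hlt := Code.encode_lt_prec f g
    simp only [EvalRule, hzero, hsucc, hpair, hd, heval f (by omega), heval g (by omega)]
  | rfind' f =>
    have hlt := Code.encode_lt_rfind' f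
    simp only [EvalRule, hzero, hsucc, hpair, h0, hd, heval f (by omega)]

theorem IsCertificate.congr {R' : ℕ → M → M → Prop} (hR : ∀ t < K + 4, R t = R' t)
    (h : IsCertificate R K) : IsCertificate R' K := by
  have h0 := hR 0 (by omega)
  have h1 := hR 1 (by omega)
  have h2 := hR 2 (by omega)
  have hzero : IsZero R = IsZero R' := by unfold IsZero; rw [h0]
  have hsucc : IsSucc R = IsSucc R' := by unfold IsSucc; rw [h0]
  have hpair : IsPair R = IsPair R' := by unfold IsPair; rw [h1, h2]
  refine ⟨h0 ▸ h.irrefl, h0 ▸ h.trans, ?_, ?_, fun d hd => ?_⟩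
  · have := h.left
    unfold LeftJustified NextLeft at this ⊢
    rwa [hzero, hsucc, hpair, h0, h1] at this
  · have := h.right
    unfold RightJustified NextRight at this ⊢
    rwa [hzero, hsucc, hpair, h0, h2] at this
  · have := h.eval d hd
    rwa [evalRule_congr fun t ht => hR t (by omega),
      show Eval R d = Eval R' d from hR _ (by omega)] at this

theorem IsZero.val_eq {x : M} (h : IsZero R x) : val R x = 0 := by
  have : {z | R 0 z x} = ∅ := Set.eq_empty_of_forall_notMem h
  simp [val, this]

variable [Finite M]

theorem IsCertificate.val_lt (h : IsCertificate R K) {x y : M} (hxy : R 0 x y) :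
    val R x < val R y :=
  Set.ncard_lt_ncard ⟨fun _ hz => h.trans _ _ _ hz hxy, fun hs => h.irrefl x (hs hxy)⟩
    (Set.toFinite _)

theorem IsCertificate.val_succ (h : IsCertificate R K) {x y : M} (hxy : IsSucc R x y) :
    val R y = val R x + 1 := by
  have : {z | R 0 z y} = insert x {z | R 0 z x} := by
    ext z
    refine ⟨hxy.2 z, ?_⟩
    rintro (rfl | hz)
    exacts [hxy.1, h.trans _ _ _ hz hxy.1]
  rw [val, this]
  exact Set.ncard_insert_of_notMem (h.irrefl x) (Set.toFinite _)

theorem val_le_card (x : M) : val R x ≤ Nat.card M := Set.ncard_le_card _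

end Certificate

/-- How the components of a pair change when its number increases by one. `NextLeft` and `NextRight`
express the cases of this recursion. -/
theorem unpair_succ (n : ℕ) : (n + 1).unpair =
    if n.unpair.1 < n.unpair.2 then
      (n.unpair.1 + 1, if n.unpair.1 + 1 < n.unpair.2 then n.unpair.2 else 0)
    else (if n.unpair.2 < n.unpair.1 then n.unpair.1 else 0, n.unpair.2 + 1) := by
  obtain ⟨⟨a, b⟩, rfl⟩ : ∃ p : ℕ × ℕ, n = Nat.pair p.1 p.2 := ⟨n.unpair, by simp⟩
  have key : ∀ c d : ℕ, Nat.pair a b + 1 = Nat.pair c d → (Nat.pair a b + 1).unpair = (c, d) := by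
    intro c d h
    rw [h, Nat.unpair_pair]
  simp only [Nat.unpair_pair]
  rcases lt_trichotomy a b with h | rfl | h
  · rw [if_pos h]
    split_ifs with h' <;> apply key
    · simp [Nat.pair, h, h', add_assoc]
    · obtain rfl : b = a + 1 := by omega
      simp [Nat.pair]
      ring
  · simp only [lt_irrefl, if_false]
    apply key
    simp [Nat.pair]
    ring
  · rw [if_neg h.not_gt, if_pos h]
    apply key
    simp [Nat.pair, h.not_gt, h.not_ge]
    ring

section Certificate

variable {M : Type} {R : ℕ → M → M → Prop} {K : ℕ} [Finite M]

/-- In a certificate the relations `R 1` and `R 2` are correct about the components of pairs, since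
the justification of each claim leads to a claim about the preceding number. -/
theorem IsCertificate.unpair (h : IsCertificate R K) (x : M) :
    (∀ a, R 1 x a → val R a = (val R x).unpair.1) ∧
      ∀ a, R 2 x a → val R a = (val R x).unpair.2 := by
  induction hn : val R x generalizing x with
  | zero =>
    constructor <;> intro a ha
    · rcases h.left x a ha with ⟨-, h0⟩ | ⟨x', _, _, hs, -, -⟩
      · simp [h0.val_eq]
      · have := h.val_succ hs
        omega
    · rcases h.right x a ha with ⟨-, h0⟩ | ⟨x', _, _, hs, -, -⟩
      · simp [h0.val_eq]
      · have := h.val_succ hs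
        omega
  | succ n ih =>
    rw [unpair_succ]
    constructor <;> intro a ha
    · rcases h.left x a ha with ⟨h0, -⟩ | ⟨x', b, c, hs, hp, hnext⟩
      · have := h0.val_eq
        omega
      · have hx' : val R x' = n := by have := h.val_succ hs; omega
        rw [← (ih x' hx').1 b hp.1, ← (ih x' hx').2 c hp.2]
        rcases hnext with ⟨h1, h2⟩ | ⟨h1, rfl⟩ | ⟨rfl, h2⟩
        · simp [h.val_lt h1, h.val_succ h2]
        · simp [h.val_lt h1, (h.val_lt h1).not_gt]
        · simp [h2.val_eq]
    · rcases h.right x a ha with ⟨h0, -⟩ | ⟨x', b, c, hs, hp, hnext⟩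
      · have := h0.val_eq
        omega
      · have hx' : val R x' = n := by have := h.val_succ hs; omega
        rw [← (ih x' hx').1 b hp.1, ← (ih x' hx').2 c hp.2]
        rcases hnext with ⟨h1, h2⟩ | ⟨rfl, h2⟩ | ⟨s, h1, h2, rfl⟩ | ⟨h1, h2⟩
        · simp [(h.val_lt h1).not_gt, h.val_succ h2]
        · simp [h.val_succ h2]
        · have := h.val_succ h1
          have := h.val_lt h2
          rw [if_pos (by omega), if_pos (by omega)]
        · simp [h.val_succ h1, h2.val_eq]

theorem IsCertificate.val_pair (h : IsCertificate R K) {x a b : M} (hp : IsPair R x a b) :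
    val R x = Nat.pair (val R a) (val R b) := by
  rw [(h.unpair x).1 a hp.1, (h.unpair x).2 b hp.2, Nat.pair_unpair]

open Nat.Partrec.Code in
theorem mem_eval_rfind'_of_zero {f : Code} {a m : ℕ} (h : 0 ∈ eval f (Nat.pair a m)) :
    m ∈ eval (.rfind' f) (Nat.pair a m) := by
  obtain ⟨k, hk⟩ := evaln_complete.1 h
  refine evaln_complete.2 ⟨k, ?_⟩
  have := evaln_bound hk
  obtain _ | k := k
  · omega
  · simp only [Option.mem_def] at hk
    simp [evaln, hk, show Nat.pair a m ≤ k by omega]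

open Nat.Partrec.Code in
theorem mem_eval_rfind'_of_succ {f : Code} {a m v y : ℕ} (h : v ∈ eval f (Nat.pair a m))
    (hv : v ≠ 0) (hy : y ∈ eval (.rfind' f) (Nat.pair a (m + 1))) :
    y ∈ eval (.rfind' f) (Nat.pair a m) := by
  obtain ⟨k, hk⟩ := evaln_complete.1 h
  obtain ⟨l, hl⟩ := evaln_complete.1 hy
  have hk' := evaln_mono (show k ≤ max k l + 1 by omega) hk
  have hl' := evaln_mono (le_max_right k l) hl
  have := evaln_bound hk
  refine evaln_complete.2 ⟨max k l + 1, ?_⟩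
  simp only [Option.mem_def] at hk' hl'
  simp [evaln, hk', hl', hv, this.le]

/-- In a certificate all claims about evaluations are correct. Inside the recursion of `prec` the
counter decreases; inside the search of `rfind'` it increases, but is bounded by the number of
elements. -/
theorem IsCertificate.mem_eval (h : IsCertificate R K) (d : Code) (hd : Encodable.encode d ≤ K)
    {x y : M} (hxy : Eval R d x y) : val R y ∈ d.eval (val R x) := by
  induction d generalizing x y with
  | zero =>
    have : IsZero R y := h.eval _ hd x y hxy
    simp [Code.eval, this.val_eq, pure, PFun.pure]
  | succ =>
    have : IsSucc R x y := h.eval _ hd x y hxy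
    simp [Code.eval, h.val_succ this]
  | left =>
    have : R 1 x y := h.eval _ hd x y hxy
    simp [Code.eval, (h.unpair x).1 y this]
  | right =>
    have : R 2 x y := h.eval _ hd x y hxy
    simp [Code.eval, (h.unpair x).2 y this]
  | pair f g hf hg =>
    have hlt := Code.encode_lt_pair f g
    obtain ⟨u, v, hu, hv, hp⟩ := h.eval _ hd x y hxy
    have h1 := hf (by omega) hu
    have h2 := hg (by omega) hv
    rw [h.val_pair hp]
    simp only [Code.eval, Seq.seq, Part.mem_bind_iff, Part.map_eq_map, Part.mem_map_iff,
      exists_exists_and_eq_and]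
    exact ⟨_, h1, _, h2, rfl⟩
  | comp f g hf hg =>
    have hlt := Code.encode_lt_comp f g
    obtain ⟨u, hu, hv⟩ := h.eval _ hd x y hxy
    exact Part.mem_bind (hg (by omega) hu) (hf (by omega) hv)
  | prec f g hf hg =>
    have hlt := Code.encode_lt_prec f g
    have key : ∀ k x y a n, IsPair R x a n → val R n = k → Eval R (.prec f g) x y →
        val R y ∈ (Code.prec f g).eval (val R x) := by
      intro k
      induction k with
      | zero =>
        intro x y a n hp hk hxy
        obtain ⟨a, n', hp', ⟨h0, hy⟩ | ⟨m, z, i, q, r, hm, hz, hi, hq, hr, hy⟩⟩ :=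
          h.eval _ hd x y hxy
        · rw [h.val_pair hp', h0.val_eq, Code.eval_prec_zero]
          exact hf (by omega) hy
        · have h1 := h.val_succ hm
          have h2 := (h.unpair x).2 _ hp.2
          have h3 := (h.unpair x).2 _ hp'.2
          omega
      | succ k ih =>
        intro x y a n hp hk hxy
        obtain ⟨a, n', hp', ⟨h0, hy⟩ | ⟨m, z, i, q, r, hm, hz, hi, hq, hr, hy⟩⟩ :=
          h.eval _ hd x y hxy
        · rw [h.val_pair hp', h0.val_eq, Code.eval_prec_zero]
          exact hf (by omega) hy
        · have h1 := h.val_succ hm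
          have h2 := (h.unpair x).2 _ hp.2
          have h3 := (h.unpair x).2 _ hp'.2
          have h4 := ih z i a m hz (by omega) hi
          have h5 := hg (by omega) hy
          rw [h.val_pair hz] at h4
          rw [h.val_pair hq, h.val_pair hr] at h5
          rw [h.val_pair hp', h1, Code.eval_prec_succ]
          exact Part.mem_bind h4 h5
    obtain ⟨a, n, hp, -⟩ := h.eval _ hd x y hxy
    exact key _ x y a n hp rfl hxy
  | rfind' f hf =>
    have hlt := Code.encode_lt_rfind' f
    have key : ∀ k x y a m, IsPair R x a m → Nat.card M - val R m = k → Eval R (.rfind' f) x y →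
        val R y ∈ (Code.rfind' f).eval (val R x) := by
      intro k
      induction k using Nat.strong_induction_on with
      | _ k ih =>
        intro x y a m hp hk hxy
        obtain ⟨a', m', v, hp', hv, ⟨h0, rfl⟩ | ⟨⟨z, hz⟩, n, x', hn, hx', hy⟩⟩ :=
          h.eval _ hd x y hxy
        · have h1 := hf (by omega) hv
          rw [h0.val_eq] at h1
          rw [h.val_pair hp'] at h1 ⊢
          exact mem_eval_rfind'_of_zero h1
        · have h1 := hf (by omega) hv
          have h2 := (h.unpair x).2 _ hp.2
          have h3 := (h.unpair x).2 _ hp'.2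
          have h4 := h.val_succ hn
          have h5 : val R n ≤ Nat.card M := val_le_card n
          have h6 := ih _ (by omega) x' y a' n hx' rfl hy
          have h7 := h.val_lt hz
          rw [h.val_pair hp'] at h1 ⊢
          rw [h.val_pair hx', h4] at h6
          exact mem_eval_rfind'_of_succ h1 (by omega) h6
    obtain ⟨a, m, -, hp, -⟩ := h.eval _ hd x y hxy
    exact key _ x y a m hp rfl hxy

end Certificate

/-! ### The certificate of a halting computation -/

/-- The true claims about natural numbers that a certificate can make, where evaluations are
restricted to `k` steps in the sense of `evaln`. The first argument is the index of the relation. -/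
def Fact (k : ℕ) : ℕ → ℕ → ℕ → Prop
  | 0, i, j => i < j
  | 1, i, j => j = i.unpair.1
  | 2, i, j => j = i.unpair.2
  | e + 3, i, j => j ∈ (Denumerable.ofNat Code e).evaln k i

/-- All values of the codes with numbers at most `K` that are computed within `k` steps are below
some bound, so that a certificate needs only finitely many numbers. -/
theorem exists_evaln_bound (k K : ℕ) : ∃ N, k ≤ N ∧ ∀ d : Code, Encodable.encode d ≤ K →
    ∀ x y, y ∈ d.evaln k x → y < N := by
  have hfin : (⋃ e ∈ Set.Iic K, ⋃ x ∈ Set.Iio k,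
      {y | y ∈ (Denumerable.ofNat Code e).evaln k x}).Finite := by
    refine (Set.finite_Iic K).biUnion fun e _ => (Set.finite_Iio k).biUnion fun x _ => ?_
    exact Set.Subsingleton.finite fun a ha b hb => Option.mem_unique ha hb
  obtain ⟨B, hB⟩ := hfin.bddAbove
  refine ⟨max k (B + 1), le_max_left _ _, fun d hd x y hy => ?_⟩
  have : y ≤ B := hB <| by
    simp only [Set.mem_iUnion]
    exact ⟨_, hd, x, Code.evaln_bound hy, by simpa using hy⟩
  omega

/-- The claims `Fact k` about the numbers below `N`, transported along a numbering `ν` of some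
elements of `M`. -/
def FactOn {M : Type} (ν : ℕ → M) (N k t : ℕ) (x y : M) : Prop :=
  ∃ i j, i < N ∧ j < N ∧ x = ν i ∧ y = ν j ∧ Fact k t i j

section Model

variable {M : Type} {ν : ℕ → M} {N k : ℕ}

theorem FactOn.eval {d : Code} {i j : ℕ} (hi : i < N) (hj : j < N) (h : j ∈ d.evaln k i) :
    Eval (FactOn ν N k) d (ν i) (ν j) :=
  ⟨i, j, hi, hj, rfl, rfl, by simpa [Fact] using h⟩

theorem FactOn.isPair {i a b : ℕ} (hi : i < N) (h : i = Nat.pair a b) :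
    IsPair (FactOn ν N k) (ν i) (ν a) (ν b) := by
  subst h
  have h1 := Nat.left_le_pair a b
  have h2 := Nat.right_le_pair a b
  exact ⟨⟨_, a, hi, by omega, rfl, rfl, by simp [Fact]⟩,
    ⟨_, b, hi, by omega, rfl, rfl, by simp [Fact]⟩⟩

theorem FactOn.lt {i j : ℕ} (hj : j < N) (h : i < j) : FactOn ν N k 0 (ν i) (ν j) :=
  ⟨i, j, by omega, hj, rfl, rfl, h⟩

variable (hν : Set.InjOn ν (Set.Iio N))

include hν

theorem FactOn.isZero (hN : 0 < N) : IsZero (FactOn ν N k) (ν 0) := by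
  rintro z ⟨i, j, hi, hj, -, h, hij⟩
  obtain rfl := hν hN hj h
  exact absurd hij (Nat.not_lt_zero _)

theorem FactOn.isSucc {i : ℕ} (hi : i + 1 < N) : IsSucc (FactOn ν N k) (ν i) (ν (i + 1)) := by
  refine ⟨FactOn.lt hi i.lt_succ_self, ?_⟩
  rintro z ⟨a, b, ha, hb, rfl, h, hab⟩
  obtain rfl := hν hi hb h
  change a < i + 1 at hab
  rcases Nat.lt_succ_iff_lt_or_eq.1 hab with h | rfl
  · exact .inr (FactOn.lt (by omega) h)
  · exact .inl rfl

theorem FactOn.leftJustified : LeftJustified (FactOn ν N k) := by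
  rintro _ _ ⟨i, a, hi, ha, rfl, rfl, rfl⟩
  obtain _ | i := i
  · exact .inl ⟨FactOn.isZero hν hi, FactOn.isZero hν hi⟩
  refine .inr ⟨ν i, ν i.unpair.1, ν i.unpair.2, FactOn.isSucc hν hi,
    FactOn.isPair (by omega) (by simp), ?_⟩
  have h1 := i.unpair_left_le
  have h2 := i.unpair_right_le
  rw [unpair_succ]
  split_ifs with h h'
  · exact .inl ⟨FactOn.lt (by omega) h, FactOn.isSucc hν (by omega)⟩
  · exact .inl ⟨FactOn.lt (by omega) h, FactOn.isSucc hν (by omega)⟩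
  · exact .inr (.inl ⟨FactOn.lt (by omega) ‹_›, rfl⟩)
  · exact .inr (.inr ⟨congrArg ν (by omega), FactOn.isZero hν (by omega)⟩)

theorem FactOn.rightJustified : RightJustified (FactOn ν N k) := by
  rintro _ _ ⟨i, a, hi, ha, rfl, rfl, rfl⟩
  obtain _ | i := i
  · exact .inl ⟨FactOn.isZero hν hi, FactOn.isZero hν hi⟩
  refine .inr ⟨ν i, ν i.unpair.1, ν i.unpair.2, FactOn.isSucc hν hi,
    FactOn.isPair (by omega) (by simp), ?_⟩
  have h1 := i.unpair_left_le
  have h2 := i.unpair_right_le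
  have h3 := (i + 1).unpair_right_le
  rw [unpair_succ] at h3 ⊢
  split_ifs at h3 ⊢ with h h'
  · exact .inr (.inr (.inl ⟨ν (i.unpair.1 + 1), FactOn.isSucc hν (by omega),
      FactOn.lt (by omega) h', rfl⟩))
  · have h4 : i.unpair.2 = i.unpair.1 + 1 := by omega
    refine .inr (.inr (.inr ⟨?_, FactOn.isZero hν (by omega)⟩))
    rw [h4]
    exact FactOn.isSucc hν (by omega)
  · exact .inl ⟨FactOn.lt (by omega) ‹_›, FactOn.isSucc hν (by omega)⟩
  · exact .inr (.inl ⟨congrArg ν (by omega), FactOn.isSucc hν (by omega)⟩)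

/-- A computation within `k` steps certifies itself: `evaln (k + 1)` refers only to `evaln (k + 1)`
on smaller codes and to `evaln k` on the same code, always on inputs bounded by `k`. -/
theorem FactOn.isCertificate {K : ℕ} (hk : k ≤ N)
    (hN : ∀ d : Code, Encodable.encode d ≤ K → ∀ x y, y ∈ d.evaln k x → y < N) :
    IsCertificate (FactOn ν N k) K where
  irrefl := by
    rintro x ⟨i, j, hi, hj, rfl, h, hij⟩
    obtain rfl := hν hi hj h
    exact lt_irrefl _ hij
  trans := by
    rintro x y z ⟨i, j, hi, hj, rfl, rfl, hij⟩ ⟨i', l, hi', hl, h, rfl, hjl⟩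
    obtain rfl := hν hj hi' h
    exact FactOn.lt hl (lt_trans (show i < j from hij) hjl)
  left := FactOn.leftJustified hν
  right := FactOn.rightJustified hν
  eval := by
    rintro d hd _ _ ⟨i, j, hi, hj, rfl, rfl, h⟩
    replace h : j ∈ d.evaln k i := by simpa [Fact] using h
    obtain _ | k := k
    · simp [Code.evaln] at h
    have hik := Code.evaln_bound h
    have hle : ∀ {c x y}, y ∈ Code.evaln k c x → y ∈ Code.evaln (k + 1) c x :=
      fun h => Code.evaln_mono k.le_succ h
    have hlt : ∀ {c x y}, y ∈ Code.evaln (k + 1) c x → x < N :=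
      fun h => (Code.evaln_bound h).trans_le hk
    cases d with
    | zero =>
      obtain rfl : j = 0 := by
        simp [Code.evaln, pure, Option.bind_eq_some_iff] at h
        exact h.2.symm
      exact FactOn.isZero hν hj
    | succ =>
      obtain rfl : j = i + 1 := by
        simp [Code.evaln, pure, Option.bind_eq_some_iff] at h
        exact h.2.symm
      exact FactOn.isSucc hν hj
    | left =>
      obtain rfl : j = i.unpair.1 := by
        simp [Code.evaln, pure, Option.bind_eq_some_iff] at h
        exact h.2.symm
      exact (FactOn.isPair hi (by simp) : IsPair _ _ _ (ν i.unpair.2)).1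
    | right =>
      obtain rfl : j = i.unpair.2 := by
        simp [Code.evaln, pure, Option.bind_eq_some_iff] at h
        exact h.2.symm
      exact (FactOn.isPair hi (by simp) : IsPair _ _ (ν i.unpair.1) _).2
    | pair f g =>
      have he := Code.encode_lt_pair f g
      simp only [Code.evaln, Seq.seq, Option.map_eq_map, Option.mem_def, Option.bind_eq_some_iff,
        Option.bind_eq_bind, Option.map_eq_some_iff] at h
      obtain ⟨-, -, _, ⟨w, hu, rfl⟩, v, hv, rfl⟩ := h
      have h1 := Nat.left_le_pair w v
      have h2 := Nat.right_le_pair w v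
      exact ⟨ν w, ν v, FactOn.eval hi (by omega) hu, FactOn.eval hi (by omega) hv,
        FactOn.isPair hj rfl⟩
    | comp f g => 
      have he := Code.encode_lt_comp f g
      simp [Code.evaln, Option.bind_eq_some_iff] at h
      obtain ⟨-, u, hu, hv⟩ := h
      exact ⟨ν u, FactOn.eval hi (hlt hv) hu, FactOn.eval (hlt hv) hj hv⟩
    | prec f g => 
      have he := Code.encode_lt_prec f g
      simp [Code.evaln, Option.bind_eq_some_iff] at h
      obtain ⟨-, h⟩ := h
      have h1 := i.unpair_left_le
      have h2 := i.unpair_right_le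
      refine ⟨ν i.unpair.1, ν i.unpair.2, FactOn.isPair hi (by simp), ?_⟩
      cases hm : i.unpair.2 with
      | zero =>
        rw [hm] at h
        exact .inl ⟨FactOn.isZero hν (by omega), FactOn.eval (by omega) hj h⟩
      | succ m =>
        rw [hm] at h
        obtain ⟨u, hu, hv⟩ := Option.bind_eq_some_iff.1 h
        have h3 := hlt hv
        have h4 := hlt (hle hu)
        have h5 := Nat.right_le_pair i.unpair.1 (Nat.pair m u)
        exact .inr ⟨ν m, ν (Nat.pair i.unpair.1 m), ν u, ν (Nat.pair i.unpair.1 (Nat.pair m u)),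
          ν (Nat.pair m u), FactOn.isSucc hν (by omega), FactOn.isPair h4 rfl,
          FactOn.eval h4 (hN _ hd _ _ (hle hu)) (hle hu), FactOn.isPair h3 rfl,
          FactOn.isPair (by omega) rfl, FactOn.eval h3 hj hv⟩
    | rfind' f => 
      have he := Code.encode_lt_rfind' f
      simp [Code.evaln, Option.bind_eq_some_iff] at h
      obtain ⟨-, v, hv, h⟩ := h
      have h1 := i.unpair_left_le
      have h2 := i.unpair_right_le
      have h3 := hN f (by omega) _ _ hv
      refine ⟨ν i.unpair.1, ν i.unpair.2, ν v, FactOn.isPair hi (by simp), FactOn.eval hi h3 hv, ?_⟩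
      split_ifs at h with h0
      · obtain rfl := Option.some.inj h
        subst h0
        exact .inl ⟨FactOn.isZero hν h3, rfl⟩
      · have h4 := hlt (hle h)
        have h5 := Nat.right_le_pair i.unpair.1 (i.unpair.2 + 1)
        exact .inr ⟨⟨ν 0, FactOn.lt h3 (Nat.pos_of_ne_zero h0)⟩, ν (i.unpair.2 + 1), _,
          FactOn.isSucc hν (by omega), FactOn.isPair h4 rfl, FactOn.eval h4 hj (hle h)⟩

end Model

/-! ### Coding binary relations in a graph -/

/-- The binary relation with index `t` coded by the relation `E` and the parameters `v`: its domain
consists of the neighbours of `v 0`, and it relates `x` to `y` if there is a path `x, u, w, y` whose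
orientation and index are marked by an edge from `u` to `v (t + 1)`. -/
def Coded {M : Type} (E : M → M → Prop) (v : ℕ → M) (t : ℕ) (x y : M) : Prop :=
  E x (v 0) ∧ E y (v 0) ∧ ∃ u w, E x u ∧ E u w ∧ E w y ∧ E u (v (t + 1))

/-- The vertices of a graph coding `K` binary relations on `N` points: the points, two inner vertices
for each index and each pair of points, and the parameters. -/
inductive Vertex (N K : ℕ) : Type
  | point (i : Fin N)
  | source (t : Fin K) (i j : Fin N)
  | target (t : Fin K) (i j : Fin N)
  | param (s : Fin (K + 1))
  deriving Fintype

/-- The edges of the graph coding the relations `P`, with an orientation. All paths of length three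
are present; an edge to the parameter marks those that belong to `P`. -/
def Arc {N K : ℕ} (P : ℕ → ℕ → ℕ → Prop) : Vertex N K → Vertex N K → Prop
  | .point _, .param s => s = 0
  | .point i, .source _ i' _ => i = i'
  | .source t i j, .target t' i' j' => t = t' ∧ i = i' ∧ j = j'
  | .target _ _ j, .point j' => j = j'
  | .source t i j, .param s => s = t.succ ∧ P t i j
  | _, _ => False

/-- The graph coding the relations `P`. -/
def codingGraph {N K : ℕ} (P : ℕ → ℕ → ℕ → Prop) : SimpleGraph (Vertex N K) where
  Adj x y := Arc P x y ∨ Arc P y x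
  symm := ⟨fun _ _ h => h.symm⟩
  loopless := ⟨fun x h => by cases x <;> simp [Arc] at h⟩

/-- The parameters of the coding graph, as an assignment to the variables `x_0, …, x_K`. -/
def paramAt (N K s : ℕ) : Vertex N K := .param (Fin.ofNat (K + 1) s)

theorem coded_codingGraph_iff {N K : ℕ} (P : ℕ → ℕ → ℕ → Prop) {t : ℕ} (ht : t < K)
    (x y : Vertex N K) : Coded (codingGraph P).Adj (paramAt N K) t x y ↔
      ∃ i j : Fin N, x = .point i ∧ y = .point j ∧ P t i j := by
  have hs : Fin.ofNat (K + 1) (t + 1) = Fin.succ ⟨t, ht⟩ := by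
    ext
    simp [Nat.mod_eq_of_lt (Nat.succ_lt_succ ht)]
  have hdom : ∀ x : Vertex N K, (codingGraph P).Adj x (paramAt N K 0) → ∃ i, x = .point i := by
    intro x hx
    cases x <;> simp_all [codingGraph, paramAt, Arc, (Fin.succ_ne_zero _).symm]
  constructor
  · rintro ⟨hx, hy, u, w, hxu, huw, hwy, hu⟩
    obtain ⟨i, rfl⟩ := hdom x hx
    obtain ⟨j, rfl⟩ := hdom y hy
    refine ⟨i, j, rfl, rfl, ?_⟩
    rw [paramAt, hs] at hu
    cases u <;> simp [codingGraph, Arc] at hu hxu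
    obtain ⟨h1, h2⟩ := hu
    cases w <;> simp [codingGraph, Arc] at huw hwy
    · grind
    · exact absurd (huw.1.symm.trans hwy) (Fin.succ_ne_zero _)
  · rintro ⟨i, j, rfl, rfl, h⟩
    refine ⟨.inl rfl, .inl rfl, .source ⟨t, ht⟩ i j, .target ⟨t, ht⟩ i j, .inl rfl,
      .inl ⟨rfl, rfl, rfl⟩, .inl rfl, .inl ?_⟩
    rw [paramAt, hs]
    exact ⟨rfl, h⟩

/-- Some evaluation of `c` is claimed on the input that is reached from `x` in `m` successor
steps. -/
def HaltsAfter {M : Type} (R : ℕ → M → M → Prop) (c : Code) : ℕ → M → Prop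
  | 0, x => ∃ y, Eval R c x y
  | m + 1, x => ∃ y, IsSucc R x y ∧ HaltsAfter R c m y

/-- The relations `R` form a certificate for the claim that `c` halts on the input `n`. -/
def CertifiesHalting {M : Type} (R : ℕ → M → M → Prop) (c : Code) (n : ℕ) : Prop :=
  IsCertificate R (Encodable.encode c) ∧ ∃ x, IsZero R x ∧ HaltsAfter R c n x

theorem CertifiesHalting.dom {M : Type} [Finite M] {R : ℕ → M → M → Prop} {c : Code} {n : ℕ}
    (h : CertifiesHalting R c n) : (c.eval n).Dom := by
  obtain ⟨hR, x, hx, hn⟩ := h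
  have key : ∀ m x, HaltsAfter R c m x → (c.eval (val R x + m)).Dom := by
    intro m
    induction m with
    | zero =>
      rintro x ⟨y, hy⟩
      exact Part.dom_iff_mem.2 ⟨_, hR.mem_eval c le_rfl hy⟩
    | succ m ih =>
      rintro x ⟨y, hxy, hy⟩
      have := ih y hy
      rwa [hR.val_succ hxy, add_assoc, add_comm 1] at this
  simpa [hx.val_eq] using key n x hn

/-- A halting computation is certified by relations coded in a finite graph. -/
theorem exists_graph_certifiesHalting {c : Code} {n : ℕ} (h : (c.eval n).Dom) :
    ∃ (V : Type) (_ : Finite V) (G : SimpleGraph V) (v : ℕ → V),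
      v 0 ≠ v 1 ∧ CertifiesHalting (Coded G.Adj v) c n := by
  obtain ⟨y, hy⟩ := Part.dom_iff_mem.1 h
  obtain ⟨k, hk⟩ := Code.evaln_complete.1 hy
  obtain ⟨N, hkN, hN⟩ := exists_evaln_bound k (Encodable.encode c)
  have hn : n < N := (Code.evaln_bound hk).trans_le hkN
  have hyN : y < N := hN c le_rfl _ _ hk
  let K := Encodable.encode c + 4
  let ν : ℕ → Vertex N K := fun i => if h : i < N then .point ⟨i, h⟩ else .param 0
  have hν : Set.InjOn ν (Set.Iio N) := by
    intro i hi j hj hij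
    simpa [ν, show i < N from hi, show j < N from hj] using hij
  have hR : ∀ t < K, FactOn ν N k t = Coded (codingGraph (Fact k)).Adj (paramAt N K) t := by
    intro t ht
    ext x y
    rw [coded_codingGraph_iff _ ht]
    constructor
    · rintro ⟨i, j, hi, hj, rfl, rfl, h⟩
      exact ⟨⟨i, hi⟩, ⟨j, hj⟩, by simp [ν, hi], by simp [ν, hj], h⟩
    · rintro ⟨i, j, rfl, rfl, h⟩
      exact ⟨i, j, i.2, j.2, by simp [ν], by simp [ν], h⟩
  have hhalt : ∀ m i, i + m = n →
      HaltsAfter (Coded (codingGraph (Fact k)).Adj (paramAt N K)) c m (ν i) := by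
    intro m
    induction m with
    | zero =>
      rintro i rfl
      refine ⟨ν y, ?_⟩
      unfold Eval
      rw [← hR _ (by omega)]
      exact FactOn.eval hn hyN hk
    | succ m ih =>
      intro i hi
      refine ⟨ν (i + 1), ?_, ih _ (by omega)⟩
      unfold IsSucc
      rw [← hR _ (by omega)]
      exact FactOn.isSucc hν (by omega)
  refine ⟨Vertex N K, inferInstance, codingGraph (Fact k), paramAt N K, ?_,
    (FactOn.isCertificate hν hkN hN).congr hR, ν 0, ?_, hhalt n 0 (by omega)⟩
  · simp [paramAt, Fin.ext_iff, K]
  · unfold IsZero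
    rw [← hR _ (by omega)]
    exact FactOn.isZero hν (by omega)

/-! ### Formula schemes -/

section Scheme

variable (L : FirstOrder.Language.{0, 0})

/-- A formula scheme: for each `n` a formula with the free variables `x_0, …, x_{n-1}`. A quantifier
at level `n` binds the variable `x_n`, so a scheme for its scope may depend on a variable index. -/
abbrev Scheme := (n : ℕ) → L.BoundedFormula Empty n

variable {L}

namespace Scheme

/-- Falsity, at every level. -/
def bot : Scheme L := fun _ => ⊥

/-- The atomic formula `r(x_i, x_j)`, or falsity at the levels where these are not variables. -/
def rel (r : L.Relations 2) (i j : ℕ) : Scheme L := fun n =>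
  if h : i < n ∧ j < n then
    r.boundedFormula₂ (Language.Term.var (.inr ⟨i, h.1⟩)) (Language.Term.var (.inr ⟨j, h.2⟩))
  else ⊥

/-- The atomic formula `x_i = x_j`, or falsity at the levels where these are not variables. -/
def eq (i j : ℕ) : Scheme L := fun n =>
  if h : i < n ∧ j < n then
    .equal (Language.Term.var (.inr ⟨i, h.1⟩)) (Language.Term.var (.inr ⟨j, h.2⟩))
  else ⊥

/-- Implication, taken at each level separately. -/
def imp (p q : Scheme L) : Scheme L := fun n => (p n).imp (q n)

/-- The universal quantification over the variable whose index is passed to `p`. -/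
def all (p : ℕ → Scheme L) : Scheme L := fun n => (p n (n + 1)).all

/-- Negation, as the implication of falsity. -/
def not (p : Scheme L) : Scheme L := imp p bot

/-- Conjunction, in terms of implication and negation. -/
def and (p q : Scheme L) : Scheme L := not (imp p (not q))

/-- Disjunction, in terms of implication and negation. -/
def or (p q : Scheme L) : Scheme L := imp (not p) q

/-- The existential quantification over the variable whose index is passed to `p`. -/
def ex (p : ℕ → Scheme L) : Scheme L := not (all fun x => not (p x))

section Sat

variable {M : Type} [L.Structure M]

/-- The truth of a scheme at level `n` under an assignment to all variables, of which only those
below `n` matter. -/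
def Sat (p : Scheme L) (n : ℕ) (v : ℕ → M) : Prop :=
  (p n).Realize (default : Empty → M) fun i : Fin n => v i

variable {p q : Scheme L} {n i j : ℕ} {v : ℕ → M}

@[simp] theorem sat_bot : ¬ Sat (M := M) (bot (L := L)) n v := id

theorem sat_rel (r : L.Relations 2) (hi : i < n) (hj : j < n) :
    Sat (rel r i j) n v ↔ Language.Structure.RelMap r ![v i, v j] := by
  simp only [Sat, rel, hi, hj, and_self, dite_true, Language.BoundedFormula.realize_rel₂]
  rfl

theorem sat_eq (hi : i < n) (hj : j < n) : Sat (eq i j : Scheme L) n v ↔ v i = v j := by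
  simp [Sat, eq, hi, hj, Language.BoundedFormula.Realize]

@[simp] theorem sat_imp : Sat (imp p q) n v ↔ (Sat p n v → Sat q n v) := Iff.rfl

@[simp] theorem sat_all {p : ℕ → Scheme L} :
    Sat (all p) n v ↔ ∀ a : M, Sat (p n) (n + 1) (Function.update v n a) := by
  have : ∀ a : M, (Fin.snoc (fun i : Fin n => v i) a : Fin (n + 1) → M) =
      fun i : Fin (n + 1) => Function.update v n a i := by
    intro a
    ext i
    refine Fin.lastCases ?_ (fun i => ?_) i
    · simp
    · simp [i.2.ne]
  simp only [Sat, all, Language.BoundedFormula.realize_all, this]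

@[simp] theorem sat_not : Sat (not p) n v ↔ ¬ Sat p n v := Iff.rfl

@[simp] theorem sat_and : Sat (and p q) n v ↔ Sat p n v ∧ Sat q n v := by
  simp [and]

@[simp] theorem sat_or : Sat (or p q) n v ↔ Sat p n v ∨ Sat q n v := by
  simp only [or, sat_imp, sat_not]
  tauto

@[simp] theorem sat_ex {p : ℕ → Scheme L} :
    Sat (ex p) n v ↔ ∃ a : M, Sat (p n) (n + 1) (Function.update v n a) := by
  simp [ex]

theorem update_of_lt (h : i < n) (a : M) : Function.update v n a i = v i :=
  Function.update_of_ne h.ne _ _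

end Sat
end Scheme

/-! ### The sentences describing certificates -/

namespace Scheme

variable (r : L.Relations 2)

/-- The scheme expressing `Coded`. -/
def coded (t x y : ℕ) : Scheme L :=
  and (rel r x 0) (and (rel r y 0)
    (ex fun u => ex fun w => and (rel r x u) (and (rel r u w) (and (rel r w y) (rel r u (t + 1))))))

/-- The scheme expressing `IsZero`. -/
def isZero (x : ℕ) : Scheme L := all fun z => not (coded r 0 z x)

/-- The scheme expressing `IsSucc`. -/
def isSucc (x y : ℕ) : Scheme L :=
  and (coded r 0 x y) (all fun z => imp (coded r 0 z y) (or (eq z x) (coded r 0 z x)))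

/-- The scheme expressing `IsPair`. -/
def isPair (x a b : ℕ) : Scheme L := and (coded r 1 x a) (coded r 2 x b)

/-- The scheme expressing `Eval`. -/
def eval (d : Code) (x y : ℕ) : Scheme L := coded r (Encodable.encode d + 3) x y

/-- The scheme expressing `NextLeft`. -/
def nextLeft (a b a' : ℕ) : Scheme L :=
  or (and (coded r 0 a b) (isSucc r a a')) (or (and (coded r 0 b a) (eq a' a))
    (and (eq a b) (isZero r a')))

/-- The scheme expressing `NextRight`. -/
def nextRight (a b b' : ℕ) : Scheme L :=
  or (and (coded r 0 b a) (isSucc r b b')) (or (and (eq a b) (isSucc r b b'))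
    (or (ex fun s => and (isSucc r a s) (and (coded r 0 s b) (eq b' b)))
      (and (isSucc r a b) (isZero r b'))))

/-- The scheme expressing `LeftJustified`. -/
def leftJustified : Scheme L := all fun x => all fun a => imp (coded r 1 x a)
  (or (and (isZero r x) (isZero r a)) (ex fun x' => ex fun b => ex fun c =>
    and (isSucc r x' x) (and (isPair r x' b c) (nextLeft r b c a))))

/-- The scheme expressing `RightJustified`. -/
def rightJustified : Scheme L := all fun x => all fun a => imp (coded r 2 x a)
  (or (and (isZero r x) (isZero r a)) (ex fun x' => ex fun b => ex fun c =>
    and (isSucc r x' x) (and (isPair r x' b c) (nextRight r b c a))))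

/-- The scheme expressing `EvalRule`. -/
def evalRule : Code → ℕ → ℕ → Scheme L
  | .zero, _, y => isZero r y
  | .succ, x, y => isSucc r x y
  | .left, x, y => coded r 1 x y
  | .right, x, y => coded r 2 x y
  | .pair f g, x, y => ex fun u => ex fun v =>
      and (eval r f x u) (and (eval r g x v) (isPair r y u v))
  | .comp f g, x, y => ex fun u => and (eval r g x u) (eval r f u y)
  | .prec f g, x, y => ex fun a => ex fun n => and (isPair r x a n)
      (or (and (isZero r n) (eval r f a y))
        (ex fun m => ex fun z => ex fun i => ex fun q => ex fun s => and (isSucc r m n)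
          (and (isPair r z a m) (and (eval r (.prec f g) z i) (and (isPair r q a s)
            (and (isPair r s m i) (eval r g q y)))))))
  | .rfind' f, x, y => ex fun a => ex fun m => ex fun v => and (isPair r x a m)
      (and (eval r f x v) (or (and (isZero r v) (eq y m))
        (and (ex fun z => coded r 0 z v) (ex fun n => ex fun z => and (isSucc r m n)
          (and (isPair r z a n) (eval r (.rfind' f) z y))))))

/-- The scheme expressing that the evaluations claimed for the codes with numbers below `k` are
justified. -/
def evalsJustified : ℕ → Scheme L
  | 0 => not bot
  | k + 1 => and (evalsJustified k) (all fun x => all fun y =>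
      imp (eval r (Denumerable.ofNat Code k) x y) (evalRule r (Denumerable.ofNat Code k) x y))

/-- The scheme expressing `IsCertificate`. -/
def isCertificate (K : ℕ) : Scheme L :=
  and (all fun x => not (coded r 0 x x)) (and
    (all fun x => all fun y => all fun z => imp (coded r 0 x y) (imp (coded r 0 y z)
      (coded r 0 x z)))
    (and (leftJustified r) (and (rightJustified r) (evalsJustified r (K + 1)))))

/-- The scheme expressing `HaltsAfter`. -/
def haltsAfter (c : Code) : ℕ → ℕ → Scheme L
  | 0, x => ex fun y => eval r c x y
  | m + 1, x => ex fun y => and (isSucc r x y) (haltsAfter c m y)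

/-- The scheme expressing `CertifiesHalting`, and that the first two parameters are different. -/
def certifiesHalting (c : Code) (n : ℕ) : Scheme L :=
  and (and (not (eq 0 1)) (isCertificate r (Encodable.encode c)))
    (ex fun x => and (isZero r x) (haltsAfter r c n x))

section Sat

variable {M : Type} [L.Structure M] {n : ℕ} {v : ℕ → M}

/-- The binary relations coded by the interpretation of `r` with the parameters `v`. -/
abbrev relOf (v : ℕ → M) : ℕ → M → M → Prop :=
  Coded (fun x y : M => Language.Structure.RelMap r ![x, y]) v

variable {r}

/-- The coded relations depend only on the values of the parameters, not on the variables bound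
later. -/
theorem relOf_update {t : ℕ} (h : t + 1 < n) (a : M) :
    relOf r (Function.update v n a) t = relOf r v t := by
  ext x y
  simp only [Coded, update_of_lt h, update_of_lt (show 0 < n by omega)]

theorem sat_coded {t x y : ℕ} (ht : t + 1 < n) (hx : x < n) (hy : y < n) :
    Sat (coded r t x y) n v ↔ relOf r v t (v x) (v y) := by
  simp (disch := omega) [coded, sat_rel, Coded]

theorem sat_isZero {x : ℕ} (hn : 1 < n) (hx : x < n) :
    Sat (isZero r x) n v ↔ IsZero (relOf r v) (v x) := by
  simp (disch := omega) [isZero, sat_coded, IsZero, relOf_update]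

theorem sat_isSucc {x y : ℕ} (hn : 1 < n) (hx : x < n) (hy : y < n) :
    Sat (isSucc r x y) n v ↔ IsSucc (relOf r v) (v x) (v y) := by
  simp (disch := omega) [isSucc, sat_coded, sat_eq, IsSucc, relOf_update]

theorem sat_isPair {x a b : ℕ} (hn : 3 < n) (hx : x < n) (ha : a < n) (hb : b < n) :
    Sat (isPair r x a b) n v ↔ IsPair (relOf r v) (v x) (v a) (v b) := by
  simp (disch := omega) [isPair, sat_coded, IsPair]

theorem sat_eval {d : Code} {x y : ℕ} (hd : Encodable.encode d + 4 < n) (hx : x < n) (hy : y < n) :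
    Sat (eval r d x y) n v ↔ Eval (relOf r v) d (v x) (v y) := by
  simp (disch := omega) [eval, sat_coded, Eval]

theorem isZero_update (hn : 1 < n) (a : M) :
    IsZero (relOf r (Function.update v n a)) = IsZero (relOf r v) := by
  unfold IsZero
  rw [relOf_update hn]

theorem isSucc_update (hn : 1 < n) (a : M) :
    IsSucc (relOf r (Function.update v n a)) = IsSucc (relOf r v) := by
  unfold IsSucc
  rw [relOf_update hn]

theorem isPair_update (hn : 3 < n) (a : M) :
    IsPair (relOf r (Function.update v n a)) = IsPair (relOf r v) := by
  unfold IsPair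
  rw [relOf_update (by omega), relOf_update (by omega)]

theorem eval_update {d : Code} (hn : Encodable.encode d + 4 < n) (a : M) :
    Eval (relOf r (Function.update v n a)) d = Eval (relOf r v) d :=
  relOf_update hn a

theorem sat_nextLeft {a b a' : ℕ} (hn : 1 < n) (ha : a < n) (hb : b < n) (ha' : a' < n) :
    Sat (nextLeft r a b a') n v ↔ NextLeft (relOf r v) (v a) (v b) (v a') := by
  simp (disch := omega) [nextLeft, sat_coded, sat_eq, sat_isSucc, sat_isZero, NextLeft]

theorem sat_nextRight {a b b' : ℕ} (hn : 1 < n) (ha : a < n) (hb : b < n) (hb' : b' < n) :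
    Sat (nextRight r a b b') n v ↔ NextRight (relOf r v) (v a) (v b) (v b') := by
  simp (disch := omega) [nextRight, sat_coded, sat_eq, sat_isSucc, sat_isZero, NextRight,
    relOf_update, isSucc_update]

theorem nextLeft_update (hn : 1 < n) (a : M) :
    NextLeft (relOf r (Function.update v n a)) = NextLeft (relOf r v) := by
  unfold NextLeft
  rw [relOf_update hn, isSucc_update hn, isZero_update hn]

theorem nextRight_update (hn : 1 < n) (a : M) :
    NextRight (relOf r (Function.update v n a)) = NextRight (relOf r v) := by
  unfold NextRight
  rw [relOf_update hn, isSucc_update hn, isZero_update hn]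

theorem sat_leftJustified (hn : 3 < n) :
    Sat (leftJustified r) n v ↔ LeftJustified (relOf r v) := by
  simp (disch := omega) [leftJustified, LeftJustified, sat_coded, sat_isSucc, sat_isZero,
    sat_isPair, sat_nextLeft, relOf_update, isSucc_update, isZero_update, isPair_update,
    nextLeft_update]

theorem sat_rightJustified (hn : 3 < n) :
    Sat (rightJustified r) n v ↔ RightJustified (relOf r v) := by
  simp (disch := omega) [rightJustified, RightJustified, sat_coded, sat_isSucc, sat_isZero,
    sat_isPair, sat_nextRight, relOf_update, isSucc_update, isZero_update, isPair_update,
    nextRight_update]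

theorem sat_evalRule {d : Code} {x y : ℕ} (hd : Encodable.encode d + 4 < n) (hx : x < n)
    (hy : y < n) : Sat (evalRule r d x y) n v ↔ EvalRule (relOf r v) d (v x) (v y) := by
  cases d with
  | zero => simp (disch := omega) [evalRule, EvalRule, sat_isZero]
  | succ => simp (disch := omega) [evalRule, EvalRule, sat_isSucc]
  | left => simp (disch := omega) [evalRule, EvalRule, sat_coded]
  | right => simp (disch := omega) [evalRule, EvalRule, sat_coded]
  | pair f g =>
    have := Code.encode_lt_pair f g
    simp (disch := omega) [evalRule, EvalRule, sat_eval, sat_isPair, eval_update, isPair_update]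
  | comp f g =>
    have := Code.encode_lt_comp f g
    simp (disch := omega) [evalRule, EvalRule, sat_eval, eval_update]
  | prec f g =>
    have := Code.encode_lt_prec f g
    simp (disch := omega) [evalRule, EvalRule, sat_eval, sat_isPair, sat_isZero, sat_isSucc,
      eval_update, isPair_update, isSucc_update, isZero_update]
  | rfind' f =>
    have := Code.encode_lt_rfind' f
    simp (disch := omega) [evalRule, EvalRule, sat_eval, sat_isPair, sat_isZero, sat_isSucc,
      sat_coded, sat_eq, eval_update, isPair_update, isSucc_update, isZero_update, relOf_update]

theorem evalRule_update {d : Code} (hn : Encodable.encode d + 4 < n) (a : M) :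
    EvalRule (relOf r (Function.update v n a)) d = EvalRule (relOf r v) d :=
  evalRule_congr fun t ht => relOf_update (by omega) a

theorem sat_evalsJustified {k : ℕ} (hn : k + 3 < n) : Sat (evalsJustified r k) n v ↔
    ∀ d : Code, Encodable.encode d < k → ∀ x y, Eval (relOf r v) d x y →
      EvalRule (relOf r v) d x y := by
  induction k with
  | zero => simp [evalsJustified]
  | succ k ih =>
    have hk : Encodable.encode (Denumerable.ofNat Code k) = k := Denumerable.encode_ofNat k
    have hlast : Sat (all fun x => all fun y =>
        imp (eval r (Denumerable.ofNat Code k) x y) (evalRule r (Denumerable.ofNat Code k) x y)) n v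
        ↔ ∀ x y, Eval (relOf r v) (Denumerable.ofNat Code k) x y →
          EvalRule (relOf r v) (Denumerable.ofNat Code k) x y := by
      simp (disch := omega) [sat_eval, sat_evalRule, eval_update, evalRule_update]
    rw [evalsJustified, sat_and, ih (by omega), hlast]
    constructor
    · rintro ⟨h1, h2⟩ d hd
      rcases Nat.lt_succ_iff_lt_or_eq.1 hd with h | rfl
      · exact h1 d h
      · simpa using h2
    · exact fun h => ⟨fun d hd => h d (by omega), h _ (by omega)⟩

theorem sat_isCertificate {K : ℕ} (hn : K + 4 < n) :
    Sat (isCertificate r K) n v ↔ IsCertificate (relOf r v) K := by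
  simp (disch := omega) [isCertificate, isCertificate_iff, sat_coded, sat_leftJustified,
    sat_rightJustified, sat_evalsJustified, relOf_update]

theorem haltsAfter_update {c : Code} {m : ℕ} (hn : Encodable.encode c + 4 < n) (a : M) :
    HaltsAfter (relOf r (Function.update v n a)) c m = HaltsAfter (relOf r v) c m := by
  ext x
  induction m generalizing x with
  | zero => simp (disch := omega) [HaltsAfter, eval_update]
  | succ m ih => simp (disch := omega) [HaltsAfter, isSucc_update, ih]

theorem sat_haltsAfter {c : Code} {m x : ℕ} (hn : Encodable.encode c + 4 < n) (hx : x < n) :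
    Sat (haltsAfter r c m x) n v ↔ HaltsAfter (relOf r v) c m (v x) := by
  induction m generalizing n v x with
  | zero => simp (disch := omega) [haltsAfter, HaltsAfter, sat_eval, eval_update]
  | succ m ih =>
    simp only [haltsAfter, sat_ex, sat_and, HaltsAfter]
    refine exists_congr fun a => and_congr ?_ ?_
    · simp (disch := omega) [sat_isSucc, isSucc_update]
    · rw [ih (by omega) (by omega), haltsAfter_update hn]
      simp

theorem sat_certifiesHalting {c : Code} {m : ℕ} (hn : Encodable.encode c + 4 < n) :
    Sat (certifiesHalting r c m) n v ↔ v 0 ≠ v 1 ∧ CertifiesHalting (relOf r v) c m := by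
  simp (disch := omega) [certifiesHalting, CertifiesHalting, sat_eq, sat_isCertificate,
    sat_isZero, sat_haltsAfter, isZero_update, haltsAfter_update, and_assoc]

end Sat
end Scheme
end Scheme

/-! ### Computability of Gödel numbers -/

section Computability

variable {L : FirstOrder.Language.{0, 0}} [L.IsRelational] [Encodable (Σ n, L.Relations n)]

namespace Scheme

variable {α : Type*} [Primcodable α] {l : α → ℕ}

theorem code_rel (r : L.Relations 2) (i j n : ℕ) : code (rel r i j n) =
    if i < n ∧ j < n then Nat.pair 2 (Nat.pair
      (Encodable.encode (⟨2, r⟩ : Σ n, L.Relations n)) (Encodable.encode [i, j])) else 0 := by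
  unfold rel
  split_ifs with h
  · simp [Language.Relations.boundedFormula₂, Language.Relations.boundedFormula, code, termCode]
  · rfl

theorem code_eq (i j n : ℕ) : code (eq i j n : L.BoundedFormula Empty n) =
    if i < n ∧ j < n then Nat.pair 1 (Nat.pair i j) else 0 := by
  unfold eq
  split_ifs with h <;> rfl

theorem primrec_code_rel (r : L.Relations 2) {i j : α → ℕ} (hi : Primrec i) (hj : Primrec j)
    (hl : Primrec l) : Primrec fun a => code (rel r (i a) (j a) (l a)) := by
  simp only [code_rel]
  refine Primrec.ite ((Primrec.nat_lt.comp hi hl).and (Primrec.nat_lt.comp hj hl))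
    (Primrec₂.natPair.comp (.const _) (Primrec₂.natPair.comp (.const _) (Primrec.encode.comp
      (Primrec.list_cons.comp hi (Primrec.list_cons.comp hj (.const _)))))) (.const _)

theorem primrec_code_eq {i j : α → ℕ} (hi : Primrec i) (hj : Primrec j)
    (hl : Primrec l) : Primrec fun a => code (eq (L := L) (i a) (j a) (l a)) := by
  simp only [code_eq]
  exact Primrec.ite ((Primrec.nat_lt.comp hi hl).and (Primrec.nat_lt.comp hj hl))
    (Primrec₂.natPair.comp (.const _) (Primrec₂.natPair.comp hi hj)) (.const _)

variable {p q : α → Scheme L}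

theorem primrec_code_imp (hp : Primrec fun a => code (p a (l a)))
    (hq : Primrec fun a => code (q a (l a))) :
    Primrec fun a => code (imp (p a) (q a) (l a)) :=
  Primrec₂.natPair.comp (.const 3) (Primrec₂.natPair.comp hp hq)

theorem primrec_code_not (hp : Primrec fun a => code (p a (l a))) :
    Primrec fun a => code (not (p a) (l a)) :=
  primrec_code_imp hp (.const _)

theorem primrec_code_and (hp : Primrec fun a => code (p a (l a)))
    (hq : Primrec fun a => code (q a (l a))) :
    Primrec fun a => code (and (p a) (q a) (l a)) :=
  primrec_code_not (primrec_code_imp hp (primrec_code_not hq))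

theorem primrec_code_or (hp : Primrec fun a => code (p a (l a)))
    (hq : Primrec fun a => code (q a (l a))) :
    Primrec fun a => code (or (p a) (q a) (l a)) :=
  primrec_code_imp (primrec_code_not hp) hq

theorem primrec_code_all {p : α → ℕ → Scheme L}
    (hp : Primrec fun a => code (p a (l a) (l a + 1))) :
    Primrec fun a => code (all (p a) (l a)) :=
  Primrec₂.natPair.comp (.const 4) hp

theorem primrec_code_ex {p : α → ℕ → Scheme L}
    (hp : Primrec fun a => code (p a (l a) (l a + 1))) :
    Primrec fun a => code (ex (p a) (l a)) :=
  primrec_code_not (primrec_code_all (primrec_code_not hp))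

variable (r : L.Relations 2)

theorem primrec_code_coded (t : ℕ) {x y : α → ℕ} (hx : Primrec x) (hy : Primrec y)
    (hl : Primrec l) : Primrec fun a => code (coded r t (x a) (y a) (l a)) := by
  have h0 : Primrec fun _ : α => 0 := .const 0
  have hl1 := Primrec.succ.comp hl
  have hl2 := Primrec.succ.comp hl1
  exact primrec_code_and (primrec_code_rel r hx h0 hl) <|
    primrec_code_and (primrec_code_rel r hy h0 hl) <| primrec_code_ex <| primrec_code_ex <|
    primrec_code_and (primrec_code_rel r hx hl hl2) <|
    primrec_code_and (primrec_code_rel r hl hl1 hl2) <|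
    primrec_code_and (primrec_code_rel r hl1 hy hl2) <|
    primrec_code_rel r hl (.const _) hl2

theorem primrec_code_isSucc {x y : α → ℕ} (hx : Primrec x) (hy : Primrec y)
    (hl : Primrec l) : Primrec fun a => code (isSucc r (x a) (y a) (l a)) := by
  have hl1 := Primrec.succ.comp hl
  exact primrec_code_and (primrec_code_coded r 0 hx hy hl) <| primrec_code_all <|
    primrec_code_imp (primrec_code_coded r 0 hl hy hl1) <|
    primrec_code_or (primrec_code_eq hl hx hl1) (primrec_code_coded r 0 hl hx hl1)

/-- The Gödel number of `∃ x, φ ∧ ψ` as a function of those of `φ` and `ψ`. -/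
def codeExAnd (a b : ℕ) : ℕ := Nat.pair 3 (Nat.pair (Nat.pair 4 (Nat.pair 3 (Nat.pair
  (Nat.pair 3 (Nat.pair (Nat.pair 3 (Nat.pair a (Nat.pair 3 (Nat.pair b 0)))) 0)) 0))) 0)

theorem primrec_codeExAnd : Primrec₂ codeExAnd := by
  have h2 := @Primrec₂.natPair
  have c0 : Primrec fun _ : ℕ × ℕ => 0 := .const 0
  have c3 : Primrec fun _ : ℕ × ℕ => 3 := .const 3
  have c4 : Primrec fun _ : ℕ × ℕ => 4 := .const 4
  exact h2.comp c3 (h2.comp (h2.comp c4 (h2.comp c3 (h2.comp (h2.comp c3 (h2.comp (h2.comp c3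
    (h2.comp .fst (h2.comp c3 (h2.comp .snd c0)))) c0)) c0))) c0)

theorem code_ex_and (p q : ℕ → Scheme L) (n : ℕ) : code (ex (fun x => and (p x) (q x)) n) =
    codeExAnd (code (p n (n + 1))) (code (q n (n + 1))) := by
  rfl

/-- A function of two arguments is primitive recursive if its recursion decreases the second
argument while it increases the first: the values are computed in reverse order, with the sum of the
two arguments as a fixed parameter. -/
theorem primrec_of_shifted_recursion {h : ℕ → ℕ → ℕ} {base step : ℕ → ℕ} {join : ℕ → ℕ → ℕ}
    (hbase : Primrec base) (hstep : Primrec step) (hjoin : Primrec₂ join)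
    (h_zero : ∀ l, h 0 l = base l) (h_succ : ∀ m l, h (m + 1) l = join (step l) (h m (l + 1))) :
    Primrec₂ h := by
  let f : ℕ → ℕ → ℕ := fun l j => Nat.rec (base l) (fun i b => join (step (l - (i + 1))) b) j
  have hg : Primrec₂ fun (l : ℕ) (p : ℕ × ℕ) => join (step (l - (p.1 + 1))) p.2 := hjoin.comp
    (hstep.comp (Primrec.nat_sub.comp .fst (Primrec.succ.comp (Primrec.fst.comp .snd))))
    (Primrec.snd.comp .snd)
  have hf : Primrec₂ f := Primrec.nat_rec hbase hg
  have key : ∀ j l, h j l = f (l + j) j := by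
    intro j
    induction j with
    | zero => exact h_zero
    | succ j ih =>
      intro l
      rw [h_succ, ih (l + 1)]
      change _ = join (step (l + (j + 1) - (j + 1))) (f (l + (j + 1)) j)
      rw [Nat.add_sub_cancel, show l + 1 + j = l + (j + 1) by omega]
  exact (hf.comp (Primrec.nat_add.comp .snd .fst) .fst).of_eq fun p => (key p.1 p.2).symm

theorem primrec_code_haltsAfter (c : Code) (k : ℕ) :
    Primrec fun m => code (haltsAfter r c m k (k + 1)) := by
  have hbase : Primrec fun l => code (haltsAfter r c 0 l (l + 1)) :=
    primrec_code_ex (primrec_code_coded r _ .id .succ (Primrec.succ.comp .succ))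
  have hstep : Primrec fun l => code (isSucc r l (l + 1) (l + 2)) :=
    primrec_code_isSucc r .id .succ (Primrec.succ.comp .succ)
  have h : Primrec₂ fun m l => code (haltsAfter r c m l (l + 1)) :=
    primrec_of_shifted_recursion hbase hstep primrec_codeExAnd (fun _ => rfl)
      fun m l => by rw [haltsAfter, code_ex_and]
  exact h.comp .id (.const k)

theorem primrec_code_certifiesHalting (c : Code) (n : ℕ) :
    Primrec fun m => code (certifiesHalting r c m n) :=
  primrec_code_and (.const _) <| primrec_code_ex <| primrec_code_and (.const _) <|
    primrec_code_haltsAfter r c n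

end Scheme

theorem primrec_code_exs {α : Type*} [Primcodable α] {n : ℕ} {f : α → L.BoundedFormula Empty n}
    (hf : Primrec fun a => code (f a)) : Primrec fun a => code (n := 0) (f a).exs := by
  induction n with
  | zero => exact hf
  | succ n ih =>
    refine ih (f := fun a => (f a).ex) ?_
    exact Primrec₂.natPair.comp (.const 3) (Primrec₂.natPair.comp (Primrec₂.natPair.comp (.const 4)
      (Primrec₂.natPair.comp (.const 3) (Primrec₂.natPair.comp hf (.const 0)))) (.const 0))

end Computability

/-! ### Finite satisfiability and closure under substructures -/

section Sentence

variable {L : FirstOrder.Language.{0, 0}} (r : L.Relations 2)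

/-- The sentence stating that the binary relation `r` codes, for some choice of parameters, a
certificate for the claim that `c` halts on the input `n`. -/
def haltingSentence (c : Code) (n : ℕ) : L.Sentence :=
  (Scheme.certifiesHalting r c n (Encodable.encode c + 5)).exs

variable {r}

theorem realize_haltingSentence {M : Type} [L.Structure M] {c : Code} {n : ℕ} :
    M ⊨ haltingSentence r c n ↔
      ∃ v : ℕ → M, v 0 ≠ v 1 ∧ CertifiesHalting (Scheme.relOf r v) c n := by
  have h := fun v : ℕ → M => Scheme.sat_certifiesHalting (r := r) (c := c) (m := n) (v := v)
    (n := Encodable.encode c + 5) (by omega)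
  simp only [← h]
  refine Language.BoundedFormula.realize_exs.trans ⟨?_, fun ⟨v, hv⟩ => ⟨_, hv⟩⟩
  rintro ⟨xs, hxs⟩
  refine ⟨fun i => xs (Fin.ofNat _ i), ?_⟩
  have : (fun i : Fin (Encodable.encode c + 5) => xs (Fin.ofNat _ (i : ℕ))) = xs := by
    ext i
    simp
  unfold Scheme.Sat
  rw [this]
  exact hxs

theorem not_realize_haltingSentence_of_subsingleton {M : Type} [L.Structure M] [Subsingleton M]
    {c : Code} {n : ℕ} : ¬ M ⊨ haltingSentence r c n := by
  rw [realize_haltingSentence]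
  rintro ⟨v, hv, -⟩
  exact hv (Subsingleton.elim _ _)

theorem dom_of_realize_haltingSentence {M : Type} [L.Structure M] [Finite M] {c : Code} {n : ℕ}
    (h : M ⊨ haltingSentence r c n) : (c.eval n).Dom := by
  obtain ⟨v, -, hv⟩ := realize_haltingSentence.1 h
  exact hv.dom

theorem modFinClosed_haltingSentence_iff [L.IsRelational] {c : Code} {n : ℕ} :
    ModFinClosed (haltingSentence r c n) ↔ ¬ (c.eval n).Dom := by
  constructor
  · intro hcl hdom
    obtain ⟨V, _, G, v, hv, hcert⟩ := exists_graph_certifiesHalting hdom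
    -- every binary symbol is interpreted as adjacency, and every other symbol as empty
    let S : L.Structure V :=
      { funMap := fun f => isEmptyElim f
        RelMap := fun {n} _ xs => ∃ h : n = 2, G.Adj (xs ⟨0, by omega⟩) (xs ⟨1, by omega⟩) }
    have hS : (fun x y : V => Language.Structure.RelMap r ![x, y]) = G.Adj := by
      ext x y
      exact ⟨fun ⟨_, h⟩ => h, fun h => ⟨rfl, h⟩⟩
    have hmodel : V ⊨ haltingSentence r c n :=
      realize_haltingSentence.2 ⟨v, hv, by rwa [Scheme.relOf, hS]⟩
    let B : L.Substructure V := Language.Substructure.closure L {v 0}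
    have hB : ∀ x, x ∈ B ↔ x = v 0 := fun x =>
      Language.Substructure.mem_closure_iff_of_isRelational L _ _
    have : Subsingleton B := ⟨fun x y => Subtype.ext (((hB _).1 x.2).trans ((hB _).1 y.2).symm)⟩
    exact not_realize_haltingSentence_of_subsingleton (hcl V hmodel B ⟨⟨v 0, (hB _).2 rfl⟩⟩)
  · intro hdom A _ _ hA
    exact absurd (dom_of_realize_haltingSentence hA) hdom

theorem graphFinClosed_haltingSentence_iff {c : Code} {n : ℕ} :
    GraphFinClosed (haltingSentence Language.adj c n) ↔ ¬ (c.eval n).Dom := by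
  constructor
  · intro hcl hdom
    obtain ⟨V, _, G, v, hv, hcert⟩ := exists_graph_certifiesHalting hdom
    have hmodel : GraphModels G (haltingSentence Language.adj c n) := by
      let := G.structure
      exact realize_haltingSentence.2 ⟨v, hv, hcert⟩
    have hsub := hcl V G hmodel {v 0} (Set.singleton_nonempty _)
    let := (G.induce {v 0}).structure
    exact not_realize_haltingSentence_of_subsingleton hsub
  · intro hdom V _ G hG
    let := G.structure
    exact absurd (dom_of_realize_haltingSentence hG) hdom

end Sentence

/-! ### Undecidability -/

/-- A recursively enumerable set of words is the set of words on whose numbers some code halts. -/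
theorem exists_code_dom_iff {W : List Bool → Prop} (hW : REPred W) :
    ∃ c : Code, ∀ w, (c.eval (Encodable.encode w)).Dom ↔ W w := by
  obtain ⟨c, hc⟩ := Code.exists_code.1 hW
  refine ⟨c, fun w => ?_⟩
  rw [hc]
  simp [Part.assert]

theorem computable_code_haltingSentence {L : FirstOrder.Language.{0, 0}} [L.IsRelational]
    [Encodable (Σ n, L.Relations n)] (r : L.Relations 2) (c : Code) :
    Computable fun w : List Bool => code (n := 0) (haltingSentence r c (Encodable.encode w)) :=
  (primrec_code_exs ((Scheme.primrec_code_certifiesHalting r c _).comp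
    (Primrec.encode (α := List Bool)))).to_comp

/-- The halting problem as a recursively enumerable set of words, the program being given by the
length of the word. -/
def HaltingWord (w : List Bool) : Prop := ((Denumerable.ofNat Code w.length).eval 0).Dom

theorem rePred_haltingWord : REPred HaltingWord :=
  Partrec.comp (ComputablePred.halting_problem_re 0)
    ((Computable.ofNat Code).comp Primrec.list_length.to_comp)

/-- A property of sentences to which the complement of the halting problem reduces is undecidable. -/
theorem not_decidableOnSentences {L : FirstOrder.Language.{0, 0}} [L.IsRelational]
    [Encodable (Σ n, L.Relations n)] {P : L.Sentence → Prop} (π : List Bool → L.Sentence)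
    (hπ : Computable fun w => code (π w)) (hP : ∀ w, P (π w) ↔ ¬ HaltingWord w) :
    ¬ DecidableOnSentences P := by
  rintro ⟨d, hd, hdec⟩
  have hword : Computable fun c : Code => List.replicate (Encodable.encode c) true := by
    have h : Primrec fun n : ℕ => (List.range n).map fun _ => true :=
      Primrec.list_map Primrec.list_range (Primrec₂.const true)
    exact (h.to_comp.comp Computable.encode).of_eq fun c => by simp [List.map_const']
  choose b hb hbP using hdec
  have hcomp : Computable fun c : Code => b (π (List.replicate (Encodable.encode c) true)) :=
    (hd.comp (hπ.comp hword)).of_eq_tot fun c => hb _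
  refine ComputablePred.halting_problem 0 (ComputablePred.computable_iff.2
    ⟨_, Primrec.not.to_comp.comp hcomp, funext fun c => propext ?_⟩)
  have h1 := hbP (π (List.replicate (Encodable.encode c) true))
  rw [hP] at h1
  simp only [HaltingWord, List.length_replicate, Denumerable.ofNat_encode] at h1
  rw [Bool.not_eq_true', ← Bool.not_eq_true, h1, not_not]

end FinClosure

theorem mainTheorem6 :
    (¬ FinClosure.DecidableOnSentences FinClosure.GraphFinClosed) ∧
    (∀ (L : FirstOrder.Language.{0, 0}) [L.IsRelational] [Finite (Σ n, L.Relations n)]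
        [Encodable (Σ n, L.Relations n)], Nonempty (L.Relations 2) →
      (¬ FinClosure.DecidableOnSentences (FinClosure.ModFinClosed (L := L))) ∧
      (∀ W : List Bool → Prop, REPred W →
        ∃ π : List Bool → L.Sentence, Computable (fun w => FinClosure.code (π w)) ∧
          ∀ w, FinClosure.ModFinClosed (π w) ↔ ¬ W w)) := by
  obtain ⟨c, hc⟩ := FinClosure.exists_code_dom_iff FinClosure.rePred_haltingWord
  refine ⟨?_, fun L _ _ _ ⟨r⟩ => ⟨?_, fun W hW => ?_⟩⟩
  · exact FinClosure.not_decidableOnSentences _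
      (FinClosure.computable_code_haltingSentence FirstOrder.Language.adj c)
      fun w => by rw [FinClosure.graphFinClosed_haltingSentence_iff, hc]
  · exact FinClosure.not_decidableOnSentences _
      (FinClosure.computable_code_haltingSentence r c)
      fun w => by rw [FinClosure.modFinClosed_haltingSentence_iff, hc]
  · obtain ⟨c, hc⟩ := FinClosure.exists_code_dom_iff hW
    exact ⟨_, FinClosure.computable_code_haltingSentence r c,
      fun w => by rw [FinClosure.modFinClosed_haltingSentence_iff, hc]⟩
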